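/- Let $\mathbb{F}_q$ be a finite field of characteristic $p$ with $3 \mid q-1$, and let $H=\{a^3 : a\in\mathbb{F}_q^\times\}$ be the subgroup of cubes in $\mathbb{F}_q^\times$. Let $\epsilon(x)=e^{2\pi i\,\mathrm{Tr}(x)/p}$ be the canonical additive character of $\mathbb{F}_q$, where $\mathrm{Tr}\colon\mathbb{F}_q\to\mathbb{F}_p$ is the absolute trace, and let $H$ act on $\mathbb{F}_q$ by multiplication. For a character $\chi\colon H\to\mathbb{C}^\times$ and sets $R,S$ of representatives of the $H$-orbits of $\mathbb{F}_q$ (if $\chi$ is trivial) or of $\mathbb{F}_q^\times$ (if $\chi$ is nontrivial), the $(\chi,R,S)$-compressed Fourier matrix is the square matrix with rows indexed by $R$, columns indexed by $S$, and $(r,s)$-entry $$\sum_{h\in H}\chi(h)\,\epsilon(h r s).$$ The pair $(\mathbb{F}_q,\chi)$ has the nonvanishing minors property if for all such $R$ and $S$ every minor of this matrix (the determinant of any square submatrix, obtained by choosing $k\ge 1$ distinct rows and $k$ distinct columns, including the whole matrix) is nonzero. Let $\chi\colon H\to\mathbb{C}^\times$ be the trivial character. Then $(\mathbb{F}_q,\chi)$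 has the nonvanishing minors property if and only if $p\equiv 1 \pmod 3$. -/

import Mathlib

/-- The canonical additive character `x ↦ exp (2 * π * i * Tr x / p)` of a finite field `F` of
characteristic `p`, where `Tr` is the absolute trace from `F` to its prime subfield. -/
noncomputable def canonicalAddChar (F : Type*) [Field F] [Finite F] : AddChar F ℂ :=
  letI : Algebra (ZMod (ringChar F)) F := ZMod.algebra F (ringChar F)
  haveI : NeZero (ringChar F) := ⟨CharP.char_ne_zero_of_finite F (ringChar F)⟩
  (ZMod.stdAddChar (N := ringChar F)).compAddMonoidHom
    (Algebra.trace (ZMod (ringChar F)) F).toAddMonoidHom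

/-- The additive character `ε_a : x ↦ ε (a * x)`, where `ε` is the canonical one. -/
noncomputable def addCharOf {F : Type*} [Field F] [Finite F] (a : F) : AddChar F ℂ :=
  (canonicalAddChar F).mulShift a

/-- Linear extension of an additive character `ψ` to the group algebra `ℂ[F]`:
`ψ (∑ f_a [a]) = ∑ f_a ψ(a)`. -/
noncomputable def AddChar.extendLinearly {F : Type*} [Field F] (ψ : AddChar F ℂ)
    (f : AddMonoidAlgebra ℂ F) : ℂ :=
  f.coeff.sum fun a c => c * ψ a

open Classical in
/-- The element `u_{χ,a} = ∑_{h ∈ H} χ(h) [h a]` of the group algebra `ℂ[F]`. -/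
noncomputable def symmElement {F : Type*} [Field F] [Fintype F] {H : Subgroup Fˣ}
    (χ : H →* ℂˣ) (a : F) : AddMonoidAlgebra ℂ F :=
  ∑ h : H, AddMonoidAlgebra.single (((h : Fˣ) : F) * a) ((χ h : ℂˣ) : ℂ)

/-- The union of the orbits that are represented: all of `F` if `χ` is trivial, and `Fˣ`
(the nonzero elements of `F`) otherwise. -/
def orbitDomain {F : Type*} [Field F] {H : Subgroup Fˣ} (χ : H →* ℂˣ) : Set F :=
  {a : F | χ = 1 ∨ a ≠ 0}

/-- `R` is a set of representatives of the `H`-orbits of `F` (if `χ` is trivial) or of `Fˣ`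
(if `χ` is nontrivial), where `H` acts by multiplication. -/
def IsOrbitReps {F : Type*} [Field F] {H : Subgroup Fˣ} (χ : H →* ℂˣ) (R : Set F) : Prop :=
  R ⊆ orbitDomain χ ∧ ∀ a ∈ orbitDomain χ, ∃! r : F, r ∈ R ∧ r ∈ MulAction.orbit H a

/-- The `(χ, R, S)`-compressed Fourier matrix, with `(r, s)`-entry `ε_s (u_{χ,r})`. -/
noncomputable def compressedFourierMatrix {F : Type*} [Field F] [Fintype F] {H : Subgroup Fˣ}
    (χ : H →* ℂˣ) (R S : Set F) : Matrix R S ℂ :=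
  Matrix.of fun r s => (addCharOf (s : F)).extendLinearly (symmElement χ (r : F))

/-- Every minor is nonzero: for all choices of `n` distinct rows and `n` distinct columns the
determinant of the resulting submatrix is nonzero. The order in which the rows and columns are
listed only changes the sign of the determinant. -/
def Matrix.HasNonvanishingMinors {m n : Type*} (M : Matrix m n ℂ) : Prop :=
  ∀ (k : ℕ) (f : Fin k ↪ m) (g : Fin k ↪ n), (M.submatrix f g).det ≠ 0

/-- The pair `(F, χ)` has the nonvanishing minors property: all the compressed Fourier matrices
`(χ, R, S)`, with `R` and `S` sets of representatives of the orbits, have it. -/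
def PairHasNonvanishingMinors {F : Type*} [Field F] [Fintype F] {H : Subgroup Fˣ}
    (χ : H →* ℂˣ) : Prop :=
  ∀ R S : Set F, IsOrbitReps χ R → IsOrbitReps χ S →
    (compressedFourierMatrix χ R S).HasNonvanishingMinors

/-- The subgroup of cubes `{a ^ 3 : a ∈ Fˣ}` of the unit group. -/
def cubes (F : Type*) [Field F] : Subgroup Fˣ :=
  (powMonoidHom 3 : Fˣ →* Fˣ).range

open Finset

/-! Write `q = 3 * m + 1` for the order of the field. There are four orbits, `{0}` and the three
classes modulo cubes, so up to reindexing there is a single 4 × 4 matrix `M`. It has the entry `m`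
in the row and column of zero, and the cubic period `η (i + j)` at `(i, j)` otherwise. Here `η i =
(y i - 1) / 3`, with `y i` the cubic Gauss sum of the class `i`.

If `p ≡ 2 [MOD 3]`, Frobenius preserves Gauss sums but swaps the two non-cube classes, so `y 1 = y
2` and a 2 × 2 minor vanishes.

If `p ≡ 1 [MOD 3]`, power sums show that the `y i` are the roots of a cubic whose only unknown
coefficient involves the number `N` of solutions of `a ^ 3 + b ^ 3 + c ^ 3 = 0`. Modulo `p`, `N` is
a product of two binomial coefficients, nonzero by Lucas (`not_dvd_fermatCubicCount`). A vanishing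
entry would force `q ∣ 1`, while each vanishing 2 × 2 minor would force `y i = y j` or `y i = q`,
hence `p ∣ N`. The 3 × 3 minors reduce to entries, since the inverse of `M` is, up to a scalar, `M`
rescaled by class sizes. -/

theorem not_dvd_choose_geom {p d : ℕ} (hp : p.Prime) (hd : p = 3 * d + 1) (j : ℕ) (hj : j ≤ 3)
    (n m : ℕ) (hm : p ^ n = 3 * m + 1) : 1 ≤ j → ¬ p ∣ (j * m).choose m := by
  intro hj1
  have := Fact.mk hp
  induction n generalizing m with
  | zero =>
    obtain rfl : m = 0 := by simpa using hm
    simpa using hp.one_lt.ne'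
  | succ n ih =>
    have hpn : 3 ∣ p ^ n - 1 := by
      have : p - 1 ∣ p ^ n - 1 := by simpa using Nat.sub_dvd_pow_sub_pow p 1 n
      exact (Dvd.intro d (by omega)).trans this
    obtain ⟨k, hk⟩ := hpn
    have hk' : p ^ n = 3 * k + 1 := by have := pow_pos hp.pos n; omega
    -- Every base `p` digit of `m` is `d`. As `j * d < p`, multiplying by `j` causes no carries, so
    -- Lucas peels off one factor `(j * d).choose d` at a time.
    have hmk : m = d + p * k := by
      rw [pow_succ, hk'] at hm
      have : 3 * m = 3 * (d + p * k) := by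
        have : (3 * k + 1) * p = 3 * (p * k) + p := by ring
        omega
      omega
    have hjd : j * d < p := by
      have : j * d ≤ 3 * d := Nat.mul_le_mul_right d hj
      omega
    have hdp : d < p := by omega
    have h := Choose.choose_modEq_choose_mod_mul_choose_div_nat (n := j * m) (k := m) (p := p)
    have e : j * m = j * d + p * (j * k) := by rw [hmk]; ring
    rw [e, hmk, Nat.add_mul_mod_self_left, Nat.add_mul_mod_self_left,
      Nat.add_mul_div_left _ _ hp.pos, Nat.add_mul_div_left _ _ hp.pos, Nat.mod_eq_of_lt hjd,
      Nat.mod_eq_of_lt hdp, Nat.div_eq_of_lt hjd, Nat.div_eq_of_lt hdp, zero_add, zero_add] at h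
    rw [e, hmk, h.dvd_iff dvd_rfl, hp.dvd_mul, not_or]
    refine ⟨fun h => ?_, ih k hk'⟩
    have h2 : p ∣ (j * d).factorial := by
      rw [← Nat.choose_mul_factorial_mul_factorial (Nat.le_mul_of_pos_left d hj1), mul_assoc]
      exact h.mul_right _
    exact absurd ((hp.dvd_factorial).1 h2) (by omega)

theorem sum_add_pow {ι κ F : Type*} [Field F] [Fintype ι] [Fintype κ] (f : ι → F)
    (g : κ → F) (n : ℕ) :
    ∑ a, ∑ b, (f a + g b) ^ n =
      ∑ j ∈ range (n + 1), (∑ a, f a ^ j) * (∑ b, g b ^ (n - j)) * n.choose j := by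
  simp_rw [add_pow, Finset.sum_mul_sum, Finset.sum_mul]
  rw [Finset.sum_comm' (t' := univ) (s' := fun _ => range (n + 1)) (by simp)]
  refine Finset.sum_congr rfl fun a _ => ?_
  rw [Finset.sum_comm]

/-! ### Counting points on the Fermat cubic modulo `p` -/

section PowerSums

variable {F : Type*} [Field F] [Fintype F]

theorem sum_cube_pow_eq_zero {m k : ℕ} (hm : Fintype.card F = 3 * m + 1) (hk : k < m) :
    ∑ a : F, (a ^ 3) ^ k = 0 := by
  simp_rw [← pow_mul]
  exact FiniteField.sum_pow_lt_card_sub_one _ _ (by omega)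

theorem sum_cube_pow_eq_neg_one {m : ℕ} (hm : Fintype.card F = 3 * m + 1) :
    ∑ a : F, (a ^ 3) ^ m = -1 := by
  classical
  have h1 : 1 < Fintype.card F := Fintype.one_lt_card
  have hs : ∀ a : F, (a ^ 3) ^ m = 1 - if a = 0 then 1 else 0 := by
    intro a
    rw [← pow_mul, show 3 * m = Fintype.card F - 1 by omega]
    split_ifs with h
    · rw [h, zero_pow (by omega), sub_self]
    · rw [FiniteField.pow_card_sub_one_eq_one a h, sub_zero]
  simp [hs]

theorem sum_add_cubes_pow_eq_zero {m n : ℕ} (hm : Fintype.card F = 3 * m + 1) (hn : n < 2 * m) :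
    ∑ x : F × F, (x.1 ^ 3 + x.2 ^ 3) ^ n = 0 := by
  refine (Fintype.sum_prod_type _).trans ((sum_add_pow (F := F) (· ^ 3) (· ^ 3) _).trans ?_)
  refine Finset.sum_eq_zero fun j _ => ?_
  rcases lt_or_ge j m with h | h
  · rw [sum_cube_pow_eq_zero hm h, zero_mul, zero_mul]
  · rw [sum_cube_pow_eq_zero (k := n - j) hm (by omega), mul_zero, zero_mul]

theorem sum_add_cubes_pow_two_mul {m : ℕ} (hm : Fintype.card F = 3 * m + 1) :
    ∑ x : F × F, (x.1 ^ 3 + x.2 ^ 3) ^ (2 * m) = ((2 * m).choose m : F) := by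
  refine (Fintype.sum_prod_type _).trans ((sum_add_pow (F := F) (· ^ 3) (· ^ 3) _).trans ?_)
  rw [Finset.sum_eq_single m]
  · rw [show 2 * m - m = m by omega, sum_cube_pow_eq_neg_one hm]; ring
  · intro j _ hj
    rcases lt_or_ge j m with h | h
    · rw [sum_cube_pow_eq_zero hm h, zero_mul, zero_mul]
    · rw [sum_cube_pow_eq_zero (k := 2 * m - j) hm (by have := Fintype.one_lt_card (α := F); omega),
        mul_zero, zero_mul]
  · intro h; simp at h; omega

/-- Each of the three cubes needs exponent at least `m` to contribute, and the total is `3 * m`, so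
only the exponents `(m, m, m)` survive. -/
theorem sum_add_three_cubes_pow {m : ℕ} (hm : Fintype.card F = 3 * m + 1) :
    ∑ c : F, ∑ x : F × F, (c ^ 3 + (x.1 ^ 3 + x.2 ^ 3)) ^ (3 * m) =
      -(((2 * m).choose m : F) * ((3 * m).choose m : F)) := by
  rw [sum_add_pow, Finset.sum_eq_single m]
  · rw [show 3 * m - m = 2 * m by omega, sum_cube_pow_eq_neg_one hm, sum_add_cubes_pow_two_mul hm]
    ring
  · intro j _ hj
    rcases lt_or_ge j m with h | h
    · rw [sum_cube_pow_eq_zero hm h, zero_mul, zero_mul]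
    · rw [sum_add_cubes_pow_eq_zero (n := 3 * m - j) hm
        (by have := Fintype.one_lt_card (α := F); omega), mul_zero, zero_mul]
  · intro h; simp at h; omega

open Classical in
/-- The number of solutions of `a ^ 3 + b ^ 3 + c ^ 3 = 0`. -/
noncomputable def fermatCubicCount (F : Type*) [Field F] [Fintype F] : ℕ :=
  ∑ c : F, ∑ x : F × F, if c ^ 3 + (x.1 ^ 3 + x.2 ^ 3) = 0 then 1 else 0

/-- The indicator of `z = 0` is `1 - z ^ (q - 1)`, as in the Chevalley–Warning argument; the
constant term sums to `q ^ 3 = 0` in `F`. -/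
theorem cast_fermatCubicCount {m : ℕ} (hm : Fintype.card F = 3 * m + 1) :
    (fermatCubicCount F : F) = ((2 * m).choose m : F) * ((3 * m).choose m : F) := by
  classical
  have h1 : 1 < Fintype.card F := Fintype.one_lt_card
  have hs : ∀ z : F, (if z = 0 then 1 else 0 : F) = 1 - z ^ (3 * m) := by
    intro z
    rw [show 3 * m = Fintype.card F - 1 by omega]
    split_ifs with h
    · rw [h, zero_pow (by omega), sub_zero]
    · rw [FiniteField.pow_card_sub_one_eq_one z h, sub_self]
  rw [fermatCubicCount]
  push_cast
  simp_rw [hs, Finset.sum_sub_distrib]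
  rw [sum_add_three_cubes_pow hm]
  simp

theorem not_dvd_fermatCubicCount {p m : ℕ} [CharP F p] (hm : Fintype.card F = 3 * m + 1)
    (hp3 : p ≡ 1 [MOD 3]) : ¬ p ∣ fermatCubicCount F := by
  have hp : p.Prime := CharP.char_is_prime F p
  obtain ⟨n, -, hn⟩ := FiniteField.card F p
  have hd : p = 3 * (p / 3) + 1 := by
    have : p % 3 = 1 := hp3
    omega
  rw [← CharP.cast_eq_zero_iff F p, cast_fermatCubicCount hm, ← Nat.cast_mul,
    CharP.cast_eq_zero_iff F p, hp.dvd_mul, not_or]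
  exact ⟨not_dvd_choose_geom hp hd 2 (by omega) n m (hn ▸ hm) (by omega),
    not_dvd_choose_geom hp hd 3 (by omega) n m (hn ▸ hm) (by omega)⟩

end PowerSums

/-! ### Cubic Gauss sums and their moments -/

theorem sum_comp_eq_card_ker_mul {G Q : Type*} [Group G] [Fintype G] [Group Q] [Fintype Q]
    (g : G →* Q) (hg : Function.Surjective g) (f : Q → ℂ) :
    ∑ a, f (g a) = Nat.card g.ker * ∑ b, f b := by
  classical
  rw [Finset.sum_comp f g, Finset.image_univ_of_surjective hg, Finset.mul_sum]
  refine Finset.sum_congr rfl fun b _ => ?_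
  rw [MonoidHom.card_fiber_eq_of_mem_range g (hg b) (hg 1), nsmul_eq_mul, Nat.card_eq_fintype_card,
    Fintype.card_subtype]
  simp only [MonoidHom.mem_ker]

theorem extendLinearly_sum_single {ι F : Type*} [Field F] [Fintype ι] (ψ : AddChar F ℂ) (a : ι → F)
    (c : ι → ℂ) :
    ψ.extendLinearly (∑ i, AddMonoidAlgebra.single (a i) (c i)) = ∑ i, c i * ψ (a i) := by
  rw [AddChar.extendLinearly, AddMonoidAlgebra.coeff_sum,
    ← Finsupp.sum_finsetSum_index (by simp) (by intros; ring)]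
  simp

section CubicSums

variable {F : Type*} [Field F] [Fintype F]

theorem canonicalAddChar_apply (p : ℕ) [CharP F p] [Fact p.Prime] [A : Algebra (ZMod p) F] (x : F) :
    canonicalAddChar F x = ZMod.stdAddChar (Algebra.trace (ZMod p) F x) := by
  obtain rfl := ringChar.eq F p
  rw [Subsingleton.elim A (ZMod.algebra F (ringChar F))]
  rfl

theorem isPrimitive_canonicalAddChar : (canonicalAddChar F).IsPrimitive := by
  have : Fact (ringChar F).Prime := ⟨CharP.char_is_prime F _⟩
  let _ : Algebra (ZMod (ringChar F)) F := ZMod.algebra F (ringChar F)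
  refine AddChar.IsPrimitive.of_ne_one fun h => ?_
  obtain ⟨x, hx⟩ := Algebra.trace_surjective (ZMod (ringChar F)) F 1
  have h1 : canonicalAddChar F x = 1 := by rw [h, AddChar.one_apply]
  rw [canonicalAddChar_apply (ringChar F), hx,
    ← AddChar.map_zero_eq_one (ZMod.stdAddChar (N := ringChar F))] at h1
  exact one_ne_zero (ZMod.injective_stdAddChar h1)

theorem canonicalAddChar_pow_char (p : ℕ) [CharP F p] (x : F) :
    canonicalAddChar F (x ^ p) = canonicalAddChar F x := by
  have : Fact p.Prime := ⟨CharP.char_is_prime F p⟩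
  let _ : Algebra (ZMod p) F := ZMod.algebra F p
  rw [canonicalAddChar_apply p, canonicalAddChar_apply p]
  congr 1
  have h := Algebra.trace_eq_of_algEquiv (FiniteField.frobeniusAlgEquivOfAlgebraic (ZMod p) F) x
  simpa [ZMod.card] using h

theorem sum_canonicalAddChar_mul [DecidableEq F] (b : F) :
    ∑ x, canonicalAddChar F (b * x) = Fintype.card F * if b = 0 then 1 else 0 := by
  simp_rw [mul_comm b]
  rw [AddChar.sum_mulShift b isPrimitive_canonicalAddChar]
  split_ifs <;> simp

/-- The cubic Gauss sum `∑ ε (a ^ 3 * x)` over all elements `a` of `F`. -/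
noncomputable def cubicGaussSum (x : F) : ℂ := ∑ a : F, canonicalAddChar F (a ^ 3 * x)

theorem cubicGaussSum_zero : cubicGaussSum (0 : F) = Fintype.card F := by
  simp [cubicGaussSum]

theorem cubicGaussSum_cube_mul {c : F} (hc : c ≠ 0) (x : F) :
    cubicGaussSum (c ^ 3 * x) = cubicGaussSum x := by
  refine Fintype.sum_equiv (Equiv.mulRight₀ c hc) _ _ fun a => ?_
  simp only [Equiv.mulRight₀_apply]
  congr 1
  ring

/-- The trace is Frobenius-invariant, and Frobenius permutes the summation variable. -/
theorem cubicGaussSum_pow_char (p : ℕ) [CharP F p] (x : F) :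
    cubicGaussSum (x ^ p) = cubicGaussSum x := by
  have : Fact p.Prime := ⟨CharP.char_is_prime F p⟩
  refine (Fintype.sum_bijective (frobenius F p) (bijective_frobenius F p) _ _ fun a => ?_).symm
  rw [frobenius_def, ← canonicalAddChar_pow_char p (a ^ 3 * x)]
  congr 1
  ring

theorem sum_cubicGaussSum : ∑ x : F, cubicGaussSum x = Fintype.card F := by
  classical
  simp only [cubicGaussSum]
  rw [Finset.sum_comm]
  simp [sum_canonicalAddChar_mul]

open Classical in
theorem sum_cubicGaussSum_sq : ∑ x : F, cubicGaussSum x ^ 2 =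
    Fintype.card F * ∑ a : F, ∑ b : F, if a ^ 3 + b ^ 3 = 0 then 1 else 0 := by
  simp_rw [cubicGaussSum, sq, Finset.sum_mul_sum, ← AddChar.map_add_eq_mul, ← add_mul]
  rw [Finset.sum_comm, Finset.mul_sum]
  refine Finset.sum_congr rfl fun a _ => ?_
  rw [Finset.sum_comm, Finset.mul_sum]
  exact Finset.sum_congr rfl fun b _ => sum_canonicalAddChar_mul _

theorem sum_cubicGaussSum_cube : ∑ x : F, cubicGaussSum x ^ 3 =
    Fintype.card F * fermatCubicCount F := by
  classical
  have h : ∀ x : F, cubicGaussSum x ^ 3 = ∑ c : F, ∑ z : F × F,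
      canonicalAddChar F ((c ^ 3 + (z.1 ^ 3 + z.2 ^ 3)) * x) := by
    intro x
    simp_rw [cubicGaussSum, pow_succ' _ 2, sq, Finset.sum_mul_sum, Fintype.sum_prod_type, add_mul,
      AddChar.map_add_eq_mul, Finset.mul_sum]
  simp_rw [h, fermatCubicCount]
  push_cast
  rw [Finset.sum_comm, Finset.mul_sum]
  refine Finset.sum_congr rfl fun a _ => ?_
  rw [Finset.sum_comm, Finset.mul_sum]
  exact Finset.sum_congr rfl fun b _ => sum_canonicalAddChar_mul _

/-- Cubing on the units has a kernel of order 3, as `3 ∣ q - 1`. -/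
theorem sum_comp_cube (h3 : 3 ∣ Fintype.card F - 1) [Fintype (cubes F)] (f : F → ℂ) :
    ∑ a : F, f (a ^ 3) = f 0 + 3 * ∑ h : cubes F, f ((h : Fˣ) : F) := by
  let _ : Fintype (powMonoidHom 3 : Fˣ →* Fˣ).range := ‹Fintype (cubes F)›
  classical
  have hker : Nat.card (powMonoidHom 3 : Fˣ →* Fˣ).rangeRestrict.ker = 3 := by
    rw [MonoidHom.ker_rangeRestrict, IsCyclic.card_powMonoidHom_ker, Nat.card_units,
      Nat.card_eq_fintype_card]
    exact Nat.gcd_eq_right h3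
  have h := sum_comp_eq_card_ker_mul (powMonoidHom 3 : Fˣ →* Fˣ).rangeRestrict
    (MonoidHom.rangeRestrict_surjective _) fun h => f ((h : Fˣ) : F)
  rw [hker] at h
  rw [Fintype.sum_eq_add_sum_compl (0 : F), zero_pow three_ne_zero]
  congr 1
  refine Eq.trans ?_ h
  symm
  refine Finset.sum_bij (fun u _ => (u : F)) ?_ ?_ ?_ ?_
  · simp
  · intro a _ b _ h; exact Units.ext h
  · intro b hb
    exact ⟨Units.mk0 b (by simpa using hb), by simp, rfl⟩
  · simp

theorem card_cubes {m : ℕ} (hm : Fintype.card F = 3 * m + 1) : Nat.card (cubes F) = m := by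
  rw [cubes, IsCyclic.card_powMonoidHom_range, Nat.card_units, Nat.card_eq_fintype_card, hm]
  simp

open Classical in
theorem sum_add_cubes_eq_zero {m : ℕ} (hm : Fintype.card F = 3 * m + 1) :
    (∑ a : F, ∑ b : F, if a ^ 3 + b ^ 3 = 0 then 1 else 0 : ℂ) = 1 + 9 * m := by
  have h3 : 3 ∣ Fintype.card F - 1 := by simp [hm]
  have hc := card_cubes hm
  rw [Nat.card_eq_fintype_card] at hc
  rw [sum_comp_cube h3 fun z => ∑ b : F, if z + b ^ 3 = 0 then (1 : ℂ) else 0]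
  have h : ∀ z : cubes F,
      (∑ b : F, if ((z : Fˣ) : F) + b ^ 3 = 0 then (1 : ℂ) else 0) = 3 := by
    intro z
    rw [sum_comp_cube h3 fun w => if ((z : Fˣ) : F) + w = 0 then (1 : ℂ) else 0]
    obtain ⟨u, hu⟩ := z.2
    -- Since `-1` is a cube, exactly one cube `w` cancels `z`, and it has three cube roots.
    have hz : -(z : Fˣ) ∈ cubes F := ⟨-u, by rw [← hu]; simp [Odd.neg_pow (by decide : Odd 3)]⟩
    rw [Finset.sum_eq_single ⟨-(z : Fˣ), hz⟩]
    · simp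
    · intro b _ hb
      rw [if_neg]
      intro hb'
      apply hb
      ext
      simpa using (neg_eq_of_add_eq_zero_right hb').symm
    · simp
  simp only [h, Finset.sum_const, Finset.card_univ, hc]
  simp
  ring

theorem cubicGaussSum_eq (h3 : 3 ∣ Fintype.card F - 1) [Fintype (cubes F)] (x : F) :
    cubicGaussSum x = 1 + 3 * ∑ h : cubes F, canonicalAddChar F (((h : Fˣ) : F) * x) := by
  classical
  rw [cubicGaussSum, sum_comp_cube h3 fun z => canonicalAddChar F (z * x)]
  simp

theorem compressedFourierMatrix_one_apply (h3 : 3 ∣ Fintype.card F - 1) {R S : Set F}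
    (r : R) (s : S) :
    compressedFourierMatrix (1 : cubes F →* ℂˣ) R S r s =
      (cubicGaussSum ((r : F) * (s : F)) - 1) / 3 := by
  classical
  rw [cubicGaussSum_eq h3, compressedFourierMatrix, Matrix.of_apply, symmElement,
    extendLinearly_sum_single, add_sub_cancel_left, mul_div_cancel_left₀ _ three_ne_zero]
  refine Fintype.sum_congr _ _ fun h => ?_
  simp only [addCharOf, AddChar.mulShift_apply, MonoidHom.one_apply, Units.val_one, one_mul]
  congr 1
  ring

end CubicSums

/-! ### Arithmetic of the cubic satisfied by the Gauss sums -/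

section Algebra

/-- The power sum identities satisfied by the three cubic Gauss sums `y i` of a field with
`3 * m + 1` elements in which `a ^ 3 + b ^ 3 + c ^ 3 = 0` has `N` solutions. -/
structure CubicPowerSums (m N : ℕ) (y : ZMod 3 → ℂ) : Prop where
  sum_eq : ∑ i, y i = 0
  sum_sq_eq : ∑ i, y i ^ 2 = 6 * (3 * m + 1)
  sum_cube_eq : (3 * m + 1) ^ 3 + m * ∑ i, y i ^ 3 = (3 * m + 1) * N

namespace CubicPowerSums

variable {m N : ℕ} {y : ZMod 3 → ℂ}

theorem sum_zmod_three (f : ZMod 3 → ℂ) {i j k : ZMod 3} (hij : i ≠ j) (hik : i ≠ k)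
    (hjk : j ≠ k) : ∑ l, f l = f i + f j + f k := by
  have : (univ : Finset (ZMod 3)) = {i, j, k} := by decide +revert
  rw [this, Finset.sum_insert (by simp [hij, hik]), Finset.sum_pair hjk, add_assoc]

theorem third (hy : CubicPowerSums m N y) {i j k : ZMod 3} (hij : i ≠ j) (hik : i ≠ k)
    (hjk : j ≠ k) : y k = -y i - y j := by
  have h := hy.sum_eq
  rw [sum_zmod_three _ hij hik hjk] at h
  linear_combination h

theorem quadratic (hy : CubicPowerSums m N y) {i j : ZMod 3} (hij : i ≠ j) :
    y i ^ 2 + y i * y j + y j ^ 2 = 3 * (3 * m + 1) := by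
  obtain ⟨k, hik, hjk⟩ : ∃ k, i ≠ k ∧ j ≠ k := by decide +revert
  have h := hy.sum_sq_eq
  rw [sum_zmod_three _ hij hik hjk, hy.third hij hik hjk] at h
  linear_combination h / 2

theorem cubic (hy : CubicPowerSums m N y) (i : ZMod 3) :
    3 * m * (y i ^ 3 - 3 * (3 * m + 1) * y i) = (3 * m + 1) * (N - (3 * m + 1) ^ 2) := by
  obtain ⟨j, k, hij, hik, hjk⟩ : ∃ j k, i ≠ j ∧ i ≠ k ∧ j ≠ k := by decide +revert
  have h := hy.sum_cube_eq
  rw [sum_zmod_three _ hij hik hjk, hy.third hij hik hjk] at h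
  linear_combination h + 3 * m * y i * hy.quadratic hij

/-- At `y i = 1` the cubic becomes an integer identity; modulo `q`, where `3 * m ≡ -1`, it reads `-1
≡ 0`. -/
theorem ne_one (hy : CubicPowerSums m N y) (hm : m ≠ 0) (i : ZMod 3) : y i ≠ 1 := by
  intro h
  have h1 := hy.cubic i
  rw [h] at h1
  have h2 : (3 * m * (1 - 3 * (3 * m + 1)) : ℤ) = (3 * m + 1) * (N - (3 * m + 1) ^ 2) := by
    have : ((3 * m * (1 - 3 * (3 * m + 1)) : ℤ) : ℂ) =
        (((3 * m + 1) * (N - (3 * m + 1) ^ 2) : ℤ) : ℂ) := by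
      push_cast; linear_combination h1
    exact_mod_cast this
  have h3 : (3 * m + 1 : ℤ) ∣ 1 :=
    ⟨-(N - (3 * m + 1) ^ 2) - 9 * m + 1, by linear_combination -h2⟩
  have := Int.le_of_dvd one_pos h3
  omega

variable {p : ℕ}

/-- At `y i = q` one factor `q` cancels from the cubic, and what remains exhibits `N` as a multiple
of `q`. -/
theorem ne_card (hy : CubicPowerSums m N y) (hpm : p ∣ 3 * m + 1) (hN : ¬ p ∣ N)
    (i : ZMod 3) : y i ≠ 3 * m + 1 := by
  intro h
  have h1 := hy.cubic i
  rw [h] at h1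
  have hq : (3 * m + 1 : ℂ) ≠ 0 := by exact_mod_cast (Nat.succ_ne_zero (3 * m))
  have h2 : (N : ℤ) = (3 * m + 1) * (3 * m * (3 * m + 1) - 3 * (3 * m) + (3 * m + 1)) := by
    have : ((N : ℤ) : ℂ) =
        (((3 * m + 1) * (3 * m * (3 * m + 1) - 3 * (3 * m) + (3 * m + 1)) : ℤ) : ℂ) := by
      push_cast
      apply mul_left_cancel₀ hq
      linear_combination -h1
    exact_mod_cast this
  apply hN
  have h3 : (p : ℤ) ∣ N := by
    rw [h2]
    exact Dvd.dvd.mul_right (by exact_mod_cast hpm) _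
  exact_mod_cast h3

/-- A double root satisfies `y i ^ 2 = q`, so the cubic becomes linear in `y i`; squaring it
eliminates `y i` and gives `q ∣ N ^ 2`. -/
theorem injective (hy : CubicPowerSums m N y) (hp : p.Prime) (hpm : p ∣ 3 * m + 1)
    (hN : ¬ p ∣ N) : Function.Injective y := by
  intro i j h
  by_contra hij
  have h0 := hy.quadratic hij
  have h1 := hy.cubic i
  rw [← h] at h0
  have h0' : y i ^ 2 = 3 * m + 1 := by linear_combination h0 / 3
  have hq : (3 * m + 1 : ℂ) ≠ 0 := by exact_mod_cast (Nat.succ_ne_zero (3 * m))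
  have h1' : -6 * m * y i = N - (3 * m + 1) ^ 2 := by
    apply mul_left_cancel₀ hq
    linear_combination h1 - 3 * m * y i * h0'
  have h2 : (N : ℤ) ^ 2 =
      (3 * m + 1) * (36 * m ^ 2 + 2 * N * (3 * m + 1) - (3 * m + 1) ^ 3) := by
    have : ((N ^ 2 : ℤ) : ℂ) =
        (((3 * m + 1) * (36 * m ^ 2 + 2 * N * (3 * m + 1) - (3 * m + 1) ^ 3) : ℤ) : ℂ) := by
      push_cast
      linear_combination 36 * m ^ 2 * h0' - (-6 * m * y i + (N - (3 * m + 1) ^ 2)) * h1'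
    exact_mod_cast this
  apply hN
  have h3 : (p : ℤ) ∣ (N : ℤ) ^ 2 := by
    rw [h2]
    exact Dvd.dvd.mul_right (by exact_mod_cast hpm) _
  exact hp.dvd_of_dvd_pow (by exact_mod_cast h3)

end CubicPowerSums

end Algebra

/-! ### Minors of the 4 × 4 period matrix -/

section Minors

/-- If `M * N` is a nonzero scalar matrix, the vanishing of a minor of `M` of size one less than
the size of `M` forces an entry of `N` to vanish. -/
theorem det_submatrix_ne_zero_of_mul_eq_smul_one {n : Type*} [Fintype n] [DecidableEq n] {k : ℕ}
    {M N : Matrix n n ℂ} {c : ℂ} (hc : c ≠ 0) (hMN : M * N = c • 1) (hN : ∀ i j, N i j ≠ 0)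
    (hk : Fintype.card n = k + 1) (f g : Fin k ↪ n) : (M.submatrix f g).det ≠ 0 := by
  have hNM : N * M = c • 1 := by
    have h : M * (c⁻¹ • N) = 1 := by
      rw [Matrix.mul_smul, hMN, smul_smul, inv_mul_cancel₀ hc, one_smul]
    have h' := mul_eq_one_comm.1 h
    rw [Matrix.smul_mul] at h'
    rw [← h', smul_smul, mul_inv_cancel₀ hc, one_smul]
  have hmiss : ∀ e : Fin k ↪ n, ∃ a, ∀ b, b ∉ Set.range e ↔ b = a := by
    intro e
    have : Fintype.card ((Set.range e)ᶜ : Set n) = 1 := by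
      rw [Fintype.card_compl_set, hk, Set.card_range_of_injective e.injective, Fintype.card_fin]
      omega
    obtain ⟨a, ha⟩ := Fintype.card_eq_one_iff.1 this
    refine ⟨a, fun b => ⟨fun hb => congrArg Subtype.val (ha ⟨b, hb⟩), ?_⟩⟩
    rintro rfl
    exact a.2
  intro hdet
  obtain ⟨v, hv0, hv⟩ := Matrix.exists_mulVec_eq_zero_iff.2 hdet
  obtain ⟨r, hr⟩ := hmiss f
  obtain ⟨s, hs⟩ := hmiss g
  -- Extended by zero, the kernel vector has `M w` supported at the omitted row `r`. Applying `N`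
  -- and reading off the omitted column `s`, where `w` vanishes, gives `N s r * (M w) r = 0`.
  let w : n → ℂ := Function.extend g v 0
  have hw : ∀ i, (M.mulVec w) (f i) = 0 := by
    intro i
    refine Eq.trans ?_ (congrFun hv i)
    simp only [Matrix.mulVec, dotProduct, Matrix.submatrix_apply]
    symm
    refine Finset.sum_of_injOn g g.injective.injOn (by simp) ?_ ?_
    · intro j _ hj
      rw [show w j = 0 from Function.extend_apply' _ _ _ (by simpa using hj), mul_zero]
    · intro j _
      rw [show w (g j) = v j from g.injective.extend_apply _ _ _]
  have hMw : M.mulVec w = Pi.single r (M.mulVec w r) := by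
    ext b
    by_cases hb : b = r
    · subst hb; simp
    · rw [Pi.single_eq_of_ne hb]
      have : b ∈ Set.range f := by by_contra h; exact hb ((hr b).1 h)
      obtain ⟨i, rfl⟩ := this
      exact hw i
  have hcw : c • w = fun b => N b r * M.mulVec w r := by
    have : N.mulVec (M.mulVec w) = c • w := by
      rw [Matrix.mulVec_mulVec, hNM, Matrix.smul_mulVec, Matrix.one_mulVec]
    rw [← this, hMw]
    ext b
    simp [Matrix.mulVec_single]
  have hws : w s = 0 := Function.extend_apply' _ _ _ ((hs s).2 rfl)
  have hz : M.mulVec w r = 0 := by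
    have := congrFun hcw s
    rw [Pi.smul_apply, hws, smul_zero] at this
    exact (mul_eq_zero.1 this.symm).resolve_left (hN s r)
  apply hv0
  ext j
  have := congrFun hcw (g j)
  rw [hz, mul_zero, Pi.smul_apply, show w (g j) = v j from g.injective.extend_apply _ _ _] at this
  exact (smul_eq_zero.1 this).resolve_left hc

/-- The compressed Fourier matrix of the trivial character, with rows and columns indexed by the
classes modulo cubes (`none` being the class of zero). -/
noncomputable def cubicPeriodMatrix (m : ℕ) (y : ZMod 3 → ℂ) :
    Matrix (Option (ZMod 3)) (Option (ZMod 3)) ℂ :=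
  Matrix.of fun
    | some i, some j => (y (i + j) - 1) / 3
    | _, _ => m

variable {m N p : ℕ} {y : ZMod 3 → ℂ}

@[simp] theorem cubicPeriodMatrix_some_some (i j : ZMod 3) :
    cubicPeriodMatrix m y (some i) (some j) = (y (i + j) - 1) / 3 := rfl

@[simp] theorem cubicPeriodMatrix_none_left (b : Option (ZMod 3)) :
    cubicPeriodMatrix m y none b = m := rfl

@[simp] theorem cubicPeriodMatrix_none_right (a : Option (ZMod 3)) :
    cubicPeriodMatrix m y a none = m := by cases a <;> rfl

theorem cubicPeriodMatrix_comm (a b : Option (ZMod 3)) :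
    cubicPeriodMatrix m y a b = cubicPeriodMatrix m y b a := by
  cases a <;> cases b <;> simp [add_comm]

theorem cubicPeriodMatrix_ne_zero (hy : CubicPowerSums m N y) (hm : m ≠ 0)
    (a b : Option (ZMod 3)) : cubicPeriodMatrix m y a b ≠ 0 := by
  rcases a with _ | i <;> rcases b with _ | j
  iterate 3 simpa using hm
  simpa [sub_eq_zero] using hy.ne_one hm (i + j)

/-- The sizes of the classes modulo cubes. -/
def cubicClassCard (m : ℕ) : Option (ZMod 3) → ℂ
  | none => 1
  | some _ => m

/-- Fourier orthogonality on orbits: summing over a class of `F` weights it by its size. -/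
theorem cubicPeriodMatrix_mul (hy : CubicPowerSums m N y) :
    cubicPeriodMatrix m y * Matrix.of (fun a b => cubicClassCard m a * cubicPeriodMatrix m y a b *
      cubicClassCard m b) = ((3 * m + 1) * m ^ 2 : ℂ) • 1 := by
  have h2 := hy.third (i := 0) (j := 1) (k := 2) (by decide) (by decide) (by decide)
  have hq := hy.quadratic (i := 0) (j := 1) (by decide)
  have e1 : (1 + 1 : ZMod 3) = 2 := rfl
  have e2 : (1 + 2 : ZMod 3) = 0 := rfl
  have e3 : (2 + 1 : ZMod 3) = 0 := rfl
  have e4 : (2 + 2 : ZMod 3) = 1 := rfl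
  have hu : ∀ f : ZMod 3 → ℂ, ∑ i, f i = f 0 + f 1 + f 2 := fun f =>
    CubicPowerSums.sum_zmod_three f (by decide) (by decide) (by decide)
  have h3 : ∀ i : ZMod 3, i = 0 ∨ i = 1 ∨ i = 2 := by decide
  have n1 : (0 : ZMod 3) ≠ 2 := by decide
  have n2 : (1 : ZMod 3) ≠ 2 := by decide
  ext a b
  rw [Matrix.mul_apply, Fintype.sum_option, hu]
  rcases a with _ | i <;> rcases b with _ | j
  · simp [cubicClassCard]; ring
  · rcases h3 j with rfl | rfl | rfl <;> simp [cubicClassCard, e1, e2, e3, e4, h2] <;> ring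
  · rcases h3 i with rfl | rfl | rfl <;> simp [cubicClassCard, e1, e2, e3, e4, h2] <;> ring
  · rcases h3 i with rfl | rfl | rfl <;> rcases h3 j with rfl | rfl | rfl <;>
      simp [cubicClassCard, e1, e2, e3, e4, h2, n1, n2, n1.symm, n2.symm] <;>
      first
      | linear_combination 2 * m ^ 2 / 9 * hq
      | linear_combination -m ^ 2 / 9 * hq

theorem cubicPeriodMatrix_some_injective (hy : CubicPowerSums m N y) (hp : p.Prime)
    (hpm : p ∣ 3 * m + 1) (hN : ¬ p ∣ N) (i : ZMod 3) :
    Function.Injective (cubicPeriodMatrix m y (some i)) := by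
  have hne : ∀ j, (y j - 1) / 3 ≠ (m : ℂ) := fun j h =>
    hy.ne_card hpm hN j (by linear_combination 3 * h)
  rintro (_ | j) (_ | k) h
  · rfl
  · exact absurd h.symm (hne _)
  · exact absurd h (hne _)
  · have h' : y (i + j) = y (i + k) := by
      simp only [cubicPeriodMatrix_some_some] at h
      linear_combination 3 * h
    rw [add_left_cancel (hy.injective hp hpm hN h')]

/-- Among the cubic periods `η i = (y i - 1) / 3`, no one is a geometric mean of the others. -/
theorem CubicPowerSums.period_sq_ne (hy : CubicPowerSums m N y) (hpm : p ∣ 3 * m + 1)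
    (hN : ¬ p ∣ N) {i j k : ZMod 3} (hij : i ≠ j) (hik : i ≠ k) (hjk : j ≠ k) :
    (y i - 1) / 3 * ((y i - 1) / 3) ≠ (y j - 1) / 3 * ((y k - 1) / 3) := by
  intro h
  apply hy.ne_card hpm hN i
  -- As `y j + y k = -y i` and `y j * y k = y i ^ 2 - 3 * q`, the squares cancel and `y i = q` is
  -- left.
  rw [hy.third hij hik hjk] at h
  linear_combination -3 * h + hy.quadratic hij / 3

theorem cubicPeriodMatrix_mul_ne (hy : CubicPowerSums m N y) (hm : m ≠ 0) (hp : p.Prime)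
    (hpm : p ∣ 3 * m + 1) (hN : ¬ p ∣ N) {a b c d : Option (ZMod 3)} (hab : a ≠ b) (hcd : c ≠ d) :
    cubicPeriodMatrix m y a c * cubicPeriodMatrix m y b d ≠
      cubicPeriodMatrix m y a d * cubicPeriodMatrix m y b c := by
  have hm' : (m : ℂ) ≠ 0 := Nat.cast_ne_zero.2 hm
  have key : ∀ {i : ZMod 3} {c d : Option (ZMod 3)}, c ≠ d →
      m * cubicPeriodMatrix m y (some i) c ≠ m * cubicPeriodMatrix m y (some i) d :=
    fun hcd h => hcd (cubicPeriodMatrix_some_injective hy hp hpm hN _ (mul_left_cancel₀ hm' h))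
  rcases a with _ | i
  · rcases b with _ | j
    · exact absurd rfl hab
    · simpa using key hcd.symm
  rcases b with _ | j
  · simpa [mul_comm _ (m : ℂ)] using key hcd
  rcases c with _ | k
  · rcases d with _ | l
    · exact absurd rfl hcd
    · have := key (i := l) hab.symm
      rw [cubicPeriodMatrix_comm (some l), cubicPeriodMatrix_comm (some l)] at this
      simpa [mul_comm _ (m : ℂ)] using this
  rcases d with _ | l
  · have := key (i := k) hab
    rw [cubicPeriodMatrix_comm (some k), cubicPeriodMatrix_comm (some k)] at this
    simpa [mul_comm _ (m : ℂ)] using this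
  rw [ne_eq, Option.some_inj] at hab hcd
  simp only [cubicPeriodMatrix_some_some]
  -- Both `i - j` and `k - l` are `±1` in `ZMod 3`, so exactly one diagonal of the minor has equal
  -- entries, and the other diagonal holds the two remaining periods.
  have h : (i + k = j + l ∧ i + k ≠ i + l ∧ i + k ≠ j + k ∧ i + l ≠ j + k) ∨
      (i + l = j + k ∧ i + l ≠ i + k ∧ i + l ≠ j + l ∧ i + k ≠ j + l) := by
    decide +revert
  rcases h with ⟨h, h1, h2, h3⟩ | ⟨h, h1, h2, h3⟩
  · rw [← h]
    exact hy.period_sq_ne hpm hN h1 h2 h3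
  · rw [← h]
    exact (hy.period_sq_ne hpm hN h1 h2 h3).symm

theorem cubicPeriodMatrix_hasNonvanishingMinors (hy : CubicPowerSums m N y) (hm : m ≠ 0)
    (hp : p.Prime) (hpm : p ∣ 3 * m + 1) (hN : ¬ p ∣ N) :
    (cubicPeriodMatrix m y).HasNonvanishingMinors := by
  have hm' : (m : ℂ) ≠ 0 := Nat.cast_ne_zero.2 hm
  have hq : (3 * m + 1 : ℂ) ≠ 0 := by exact_mod_cast (Nat.succ_ne_zero (3 * m))
  have hc : ((3 * m + 1) * m ^ 2 : ℂ) ≠ 0 := mul_ne_zero hq (pow_ne_zero 2 hm')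
  have hcard : Fintype.card (Option (ZMod 3)) = 4 := by simp
  intro k f g
  have hk : k ≤ 4 := by simpa using Fintype.card_le_of_embedding f
  interval_cases k
  · simp
  · rw [Matrix.det_fin_one]
    exact cubicPeriodMatrix_ne_zero hy hm _ _
  · rw [Matrix.det_fin_two, sub_ne_zero]
    exact cubicPeriodMatrix_mul_ne hy hm hp hpm hN (f.injective.ne zero_ne_one)
      (g.injective.ne zero_ne_one)
  · refine det_submatrix_ne_zero_of_mul_eq_smul_one hc (cubicPeriodMatrix_mul hy) ?_ hcard f g
    have hcc : ∀ a, cubicClassCard m a ≠ 0 := by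
      rintro (_ | _)
      · exact one_ne_zero
      · exact hm'
    exact fun a b => mul_ne_zero (mul_ne_zero (hcc a) (cubicPeriodMatrix_ne_zero hy hm a b)) (hcc b)
  · have hdet : (cubicPeriodMatrix m y).det ≠ 0 := by
      intro h
      have h1 := congrArg Matrix.det (cubicPeriodMatrix_mul hy)
      rw [Matrix.det_mul, h, zero_mul, Matrix.det_smul, Matrix.det_one, mul_one] at h1
      exact pow_ne_zero _ hc h1.symm
    have hf : Function.Bijective f := (Fintype.bijective_iff_injective_and_card f).2
      ⟨f.injective, by simp⟩
    have hg : Function.Bijective g := (Fintype.bijective_iff_injective_and_card g).2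
      ⟨g.injective, by simp⟩
    rw [← isUnit_iff_ne_zero, ← Matrix.isUnit_iff_isUnit_det] at hdet ⊢
    exact (Matrix.isUnit_submatrix_equiv (Equiv.ofBijective f hf) (Equiv.ofBijective g hg)).2 hdet

end Minors

theorem Matrix.HasNonvanishingMinors.submatrix {m n m' n' : Type*} {M : Matrix m n ℂ}
    (hM : M.HasNonvanishingMinors) (e : m' ↪ m) (e' : n' ↪ n) :
    (M.submatrix e e').HasNonvanishingMinors := fun k f g => by
  rw [Matrix.submatrix_submatrix]
  exact hM k (f.trans e) (g.trans e')

/-! ### Orbits as classes modulo cubes, and reduction to the period matrix -/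

section Classes

variable {F : Type*} [Field F] {l : Fˣ →* Multiplicative (ZMod 3)}

open Classical in
/-- The class modulo cubes of an element of `F`, given by a homomorphism `l` from the units to
`ZMod 3`; the class of zero is `none`. -/
noncomputable def cubicClass (l : Fˣ →* Multiplicative (ZMod 3)) (x : F) : Option (ZMod 3) :=
  if h : x = 0 then none else some (l (Units.mk0 x h)).toAdd

@[simp] theorem cubicClass_zero : cubicClass l 0 = none := by simp [cubicClass]

@[simp] theorem cubicClass_unit (u : Fˣ) : cubicClass l (u : F) = some (l u).toAdd := by
  simp [cubicClass]

theorem eq_zero_or_eq_unit (x : F) : x = 0 ∨ ∃ u : Fˣ, x = u := by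
  rcases eq_or_ne x 0 with h | h
  · exact Or.inl h
  · exact Or.inr ⟨Units.mk0 x h, rfl⟩

theorem cubicClass_surjective (hl : Function.Surjective l) : Function.Surjective (cubicClass l) := by
  rintro (_ | i)
  · exact ⟨0, cubicClass_zero⟩
  · obtain ⟨u, hu⟩ := hl (Multiplicative.ofAdd i)
    exact ⟨u, by simp [hu]⟩

theorem mem_orbit_cubes_iff (hker : l.ker = cubes F) (x a : F) :
    x ∈ MulAction.orbit (cubes F) a ↔ cubicClass l x = cubicClass l a := by
  constructor
  · rintro ⟨⟨h, hh⟩, rfl⟩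
    rw [← hker, MonoidHom.mem_ker] at hh
    change cubicClass l ((h : F) * a) = _
    rcases eq_zero_or_eq_unit a with rfl | ⟨u, rfl⟩
    · rw [mul_zero]
    · rw [← Units.val_mul, cubicClass_unit, cubicClass_unit, map_mul, hh, one_mul]
  · intro h
    rcases eq_zero_or_eq_unit a with rfl | ⟨u, rfl⟩ <;>
      rcases eq_zero_or_eq_unit x with rfl | ⟨v, rfl⟩
    · exact MulAction.mem_orbit_self _
    · simp at h
    · simp at h
    · simp only [cubicClass_unit, Option.some_inj, EmbeddingLike.apply_eq_iff_eq] at h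
      have hv : v * u⁻¹ ∈ cubes F := by
        rw [← hker, MonoidHom.mem_ker, map_mul, map_inv, h, mul_inv_cancel]
      refine ⟨⟨v * u⁻¹, hv⟩, ?_⟩
      change ((v * u⁻¹ : Fˣ) : F) * u = v
      rw [← Units.val_mul, inv_mul_cancel_right]

theorem IsOrbitReps.bijective_cubicClass (hl : Function.Surjective l) (hker : l.ker = cubes F)
    {R : Set F} (hR : IsOrbitReps (1 : cubes F →* ℂˣ) R) :
    Function.Bijective fun r : R => cubicClass l (r : F) := by
  constructor
  · intro r s h
    obtain ⟨t, -, ht⟩ := hR.2 s (Or.inl rfl)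
    exact Subtype.ext ((ht r ⟨r.2, (mem_orbit_cubes_iff hker _ _).2 h⟩).trans
      (ht s ⟨s.2, MulAction.mem_orbit_self _⟩).symm)
  · intro c
    obtain ⟨a, rfl⟩ := cubicClass_surjective hl c
    obtain ⟨r, ⟨hr, hra⟩, -⟩ := hR.2 a (Or.inl rfl)
    exact ⟨⟨r, hr⟩, (mem_orbit_cubes_iff hker _ _).1 hra⟩

theorem exists_isOrbitReps (hl : Function.Surjective l) (hker : l.ker = cubes F) :
    ∃ R : Set F, IsOrbitReps (1 : cubes F →* ℂˣ) R := by
  refine ⟨Set.range (Function.surjInv (cubicClass_surjective hl)), fun _ _ => Or.inl rfl,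
    fun a _ => ⟨Function.surjInv (cubicClass_surjective hl) (cubicClass l a), ⟨⟨_, rfl⟩, ?_⟩, ?_⟩⟩
  · rw [mem_orbit_cubes_iff hker, Function.surjInv_eq (cubicClass_surjective hl)]
  · rintro _ ⟨⟨c, rfl⟩, h⟩
    rw [mem_orbit_cubes_iff hker, Function.surjInv_eq (cubicClass_surjective hl)] at h
    rw [h]

variable [Fintype F]

theorem exists_cubic_index (h3 : 3 ∣ Fintype.card F - 1) :
    ∃ l : Fˣ →* Multiplicative (ZMod 3), Function.Surjective l ∧ l.ker = cubes F := by
  have hcard : Nat.card (Fˣ ⧸ cubes F) = 3 := by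
    have h := IsCyclic.index_powMonoidHom_range (G := Fˣ) 3
    rw [Nat.card_units, Nat.card_eq_fintype_card, Nat.gcd_eq_right h3] at h
    exact h
  have : Fact (Nat.Prime 3) := ⟨Nat.prime_three⟩
  let e : Fˣ ⧸ cubes F ≃* Multiplicative (ZMod 3) :=
    mulEquivOfPrimeCardEq (p := 3) hcard (by simp)
  refine ⟨e.toMonoidHom.comp (QuotientGroup.mk' (cubes F)),
    e.surjective.comp (QuotientGroup.mk'_surjective _), ?_⟩
  ext u
  simp

theorem exists_cubicGaussSum_eq (hl : Function.Surjective l) (hker : l.ker = cubes F) :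
    ∃ y : ZMod 3 → ℂ, ∀ u : Fˣ, cubicGaussSum (u : F) = y (l u).toAdd := by
  refine ⟨fun i => cubicGaussSum ((Function.surjInv hl (Multiplicative.ofAdd i) : Fˣ) : F),
    fun u => ?_⟩
  set v := Function.surjInv hl (Multiplicative.ofAdd (l u).toAdd) with hv
  have hlv : l v = l u := Function.surjInv_eq hl _
  have : u * v⁻¹ ∈ cubes F := by
    rw [← hker, MonoidHom.mem_ker, map_mul, map_inv, hlv, mul_inv_cancel]
  obtain ⟨c, hc⟩ := this
  have hu : (u : F) = (c : F) ^ 3 * v := by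
    rw [← Units.val_pow_eq_pow_val, ← Units.val_mul]
    congr 1
    rw [eq_mul_inv_iff_mul_eq] at hc
    exact hc.symm
  rw [hu, cubicGaussSum_cube_mul c.ne_zero]

variable {m : ℕ} {y : ZMod 3 → ℂ}

/-- Turns moments over `F` into power sums of the three `y i`: zero contributes the value `q`, and
each class has `m` elements. -/
theorem sum_comp_cubicGaussSum (hm : Fintype.card F = 3 * m + 1) (hl : Function.Surjective l)
    (hker : l.ker = cubes F) (hy : ∀ u : Fˣ, cubicGaussSum (u : F) = y (l u).toAdd) (f : ℂ → ℂ) :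
    ∑ x : F, f (cubicGaussSum x) = f (3 * m + 1) + m * ∑ i, f (y i) := by
  classical
  have h := sum_comp_eq_card_ker_mul l hl fun i => f (y i.toAdd)
  rw [hker, card_cubes hm] at h
  rw [Fintype.sum_eq_add_sum_compl (0 : F), cubicGaussSum_zero, hm]
  push_cast
  congr 1
  refine Eq.trans ?_ h
  symm
  refine Finset.sum_bij (fun u _ => (u : F)) ?_ ?_ ?_ ?_
  · simp
  · intro a _ b _ h; exact Units.ext h
  · intro b hb
    exact ⟨Units.mk0 b (by simpa using hb), by simp, rfl⟩
  · simp [hy]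

theorem cubicPowerSums (hm : Fintype.card F = 3 * m + 1) (hm0 : m ≠ 0)
    (hl : Function.Surjective l) (hker : l.ker = cubes F)
    (hy : ∀ u : Fˣ, cubicGaussSum (u : F) = y (l u).toAdd) :
    CubicPowerSums m (fermatCubicCount F) y := by
  classical
  have hm' : (m : ℂ) ≠ 0 := Nat.cast_ne_zero.2 hm0
  have h1 := sum_comp_cubicGaussSum hm hl hker hy id
  have h2 := sum_comp_cubicGaussSum hm hl hker hy (· ^ 2)
  have h3 := sum_comp_cubicGaussSum hm hl hker hy (· ^ 3)
  simp only [id_eq] at h1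
  rw [sum_cubicGaussSum, hm] at h1
  rw [sum_cubicGaussSum_sq, sum_add_cubes_eq_zero hm, hm] at h2
  rw [sum_cubicGaussSum_cube, hm] at h3
  push_cast at h1 h2 h3
  refine ⟨?_, ?_, h3.symm⟩
  · apply mul_left_cancel₀ hm'
    linear_combination -h1
  · apply mul_left_cancel₀ hm'
    linear_combination -h2

theorem compressedFourierMatrix_one_eq (hm : Fintype.card F = 3 * m + 1)
    (hy : ∀ u : Fˣ, cubicGaussSum (u : F) = y (l u).toAdd) (R S : Set F) :
    compressedFourierMatrix (1 : cubes F →* ℂˣ) R S =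
      (cubicPeriodMatrix m y).submatrix (fun r : R => cubicClass l (r : F))
        fun s : S => cubicClass l (s : F) := by
  ext ⟨r, hr⟩ ⟨s, hs⟩
  rw [compressedFourierMatrix_one_apply (by simp [hm]), Matrix.submatrix_apply]
  rcases eq_zero_or_eq_unit r with rfl | ⟨u, rfl⟩
  · simp [cubicGaussSum_zero, hm]
  rcases eq_zero_or_eq_unit s with rfl | ⟨v, rfl⟩
  · simp [cubicGaussSum_zero, hm]
  · rw [← Units.val_mul, hy]
    simp

theorem pairHasNonvanishingMinors_one_iff (hm : Fintype.card F = 3 * m + 1)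
    (hl : Function.Surjective l) (hker : l.ker = cubes F)
    (hy : ∀ u : Fˣ, cubicGaussSum (u : F) = y (l u).toAdd) :
    PairHasNonvanishingMinors (1 : cubes F →* ℂˣ) ↔
      (cubicPeriodMatrix m y).HasNonvanishingMinors := by
  constructor
  · intro h
    obtain ⟨R, hR⟩ := exists_isOrbitReps hl hker
    have hRR := h R R hR hR
    rw [compressedFourierMatrix_one_eq hm hy] at hRR
    let e := Equiv.ofBijective _ (hR.bijective_cubicClass hl hker)
    have := hRR.submatrix e.symm.toEmbedding e.symm.toEmbedding
    rw [Matrix.submatrix_submatrix] at this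
    convert this
    ext a b
    rw [Matrix.submatrix_apply]
    exact congrArg₂ _ (e.apply_symm_apply a).symm (e.apply_symm_apply b).symm
  · intro h R S hR hS
    rw [compressedFourierMatrix_one_eq hm hy]
    exact h.submatrix ⟨_, (hR.bijective_cubicClass hl hker).1⟩
      ⟨_, (hS.bijective_cubicClass hl hker).1⟩

theorem not_hasNonvanishingMinors_of_eq (h : y 1 = y 2) :
    ¬ (cubicPeriodMatrix m y).HasNonvanishingMinors := by
  intro hM
  -- This minor is `m * (η 2 - η 1)`.
  apply hM 2 ⟨![none, some 0], by decide⟩ ⟨![some 1, some 2], by decide⟩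
  rw [Matrix.det_fin_two]
  simp [h]

/-- Raising to the power `p` multiplies the class in `ZMod 3` by `p = 2`, sending class 1 to class
2. -/
theorem cubicGaussSum_class_one_eq_two {p : ℕ} [CharP F p] (hp : p ≡ 2 [MOD 3])
    (hl : Function.Surjective l) (hy : ∀ u : Fˣ, cubicGaussSum (u : F) = y (l u).toAdd) :
    y 1 = y 2 := by
  obtain ⟨u, hu⟩ := hl (Multiplicative.ofAdd 1)
  have h := cubicGaussSum_pow_char p (u : F)
  have h2 : (p : ZMod 3) = 2 := by
    have := (ZMod.natCast_eq_natCast_iff p 2 3).2 hp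
    simpa using this
  rw [← Units.val_pow_eq_pow_val, hy, hy, map_pow, hu, toAdd_pow, toAdd_ofAdd, nsmul_one, h2] at h
  exact h.symm

end Classes

/-! ### The equivalence -/

theorem mainTheorem8 {F : Type*} [Field F] [Fintype F] (p : ℕ) [CharP F p]
    (h3 : 3 ∣ Fintype.card F - 1) :
    PairHasNonvanishingMinors (1 : cubes F →* ℂˣ) ↔ p ≡ 1 [MOD 3] := by
  obtain ⟨m, hm⟩ := h3
  have h1 : 1 < Fintype.card F := Fintype.one_lt_card
  have hm' : Fintype.card F = 3 * m + 1 := by omega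
  have hm0 : m ≠ 0 := by omega
  have hp : p.Prime := CharP.char_is_prime F p
  have hpm : p ∣ 3 * m + 1 := by
    rw [← hm', ← CharP.cast_eq_zero_iff F p, FiniteField.cast_card_eq_zero]
  obtain ⟨l, hl, hker⟩ := exists_cubic_index (F := F) ⟨m, hm⟩
  obtain ⟨y, hy⟩ := exists_cubicGaussSum_eq hl hker
  rw [pairHasNonvanishingMinors_one_iff hm' hl hker hy]
  constructor
  · intro h
    by_contra hp1
    -- `p` divides `q`, which is 1 modulo 3, so only the residue 2 is left.
    have hp0 : ¬ 3 ∣ p := fun h => by have := h.trans hpm; omega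
    have hp2 : p ≡ 2 [MOD 3] := by
      have : ¬ p % 3 = 1 := hp1
      change p % 3 = 2
      omega
    exact not_hasNonvanishingMinors_of_eq (cubicGaussSum_class_one_eq_two hp2 hl hy) h
  · intro h
    exact cubicPeriodMatrix_hasNonvanishingMinors (cubicPowerSums hm' hm0 hl hker hy) hm0 hp hpm
      (not_dvd_fermatCubicCount hm' h)
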